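/- All graphs are finite and simple, and a \emph{property} is an isomorphism-closed class of graphs. A property $\mathcal P$ is \emph{hereditary} if it is closed under (not necessarily induced) subgraphs, \emph{hereditary compositive} if it is hereditary and any two graphs in $\mathcal P$ are both subgraphs of some graph in $\mathcal P$, and \emph{additive} if it is closed under vertex-disjoint unions. The \emph{product} $\mathcal P_1\circ\cdots\circ\mathcal P_m$ consists of the graphs $G$ whose vertex set has a partition $V_1,\dots,V_m$ into possibly empty parts such that $G[V_i]\in\mathcal P_i$ for each $i$ with $V_i\neq\emptyset$; for $m=0$ it contains only the null graph. A graph is \emph{decomposable} if it is the join of two non-null graphs, and \emph{indecomposable} otherwise. Every graph $G$ is uniquely the join of indecomposable non-null graphs, its \emph{ind-parts}; their number is $dc(G)$. Let $\mathcal P$ be a hereditary property that contains some graph but not all graphs. A graph $G\in\mathcal P$ is \emph{$\mathcal P$-maximal} if $G+e\notin\mathcal P$ for every edge $e$ of the complement of $G$. Let $c(\mathcal P)$ be the largest $r$ with $K_r\in\mathcal P$, let $\mathcal M^*(\mathcal P)$ be the set of $\mathcal P$-maximal graphs with at least $c(\mathcal P)$ vertices, and put $dc(\mathcal P)=\min\{dc(G):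 G\in\mathcal M^*(\mathcal P)\}$. The property $\mathcal P$ is \emph{indecomposable} if $dc(\mathcal P)=1$. \textbf{Theorem.} Let $\mathcal P$ be a hereditary compositive property that contains some graph but not all graphs, and let $d=dc(\mathcal P)$. Then there are hereditary compositive properties $\mathcal P_1,\dots,\mathcal P_d$, each containing a non-null graph, with $\mathcal P=\mathcal P_1\circ\cdots\circ\mathcal P_d$, and in every such factorisation of $\mathcal P$ into $d$ factors each factor is indecomposable. If moreover $\mathcal P$ is additive, then there is such a factorisation in which every $\mathcal P_i$ is additive. -/

import Mathlib

open SimpleGraph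

/-- A graph property: an isomorphism-closed class of finite simple graphs. -/
@[ext]
structure GraphProperty where
  /-- membership of a finite graph in the property -/
  Mem : ∀ {V : Type} [Finite V], SimpleGraph V → Prop
  iso : ∀ {V W : Type} [Finite V] [Finite W] {G : SimpleGraph V} {H : SimpleGraph W},
    (G ≃g H) → Mem G → Mem H

namespace GraphProperty

/-- Some finite graph belongs to `P`. -/
def HasMember (P : GraphProperty) : Prop :=
  ∃ (V : Type) (_ : Finite V) (G : SimpleGraph V), P.Mem G

/-- Some finite graph with at least one vertex belongs to `P`. -/
def HasNonnullMember (P : GraphProperty) : Prop :=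
  ∃ (V : Type) (_ : Finite V) (G : SimpleGraph V), Nonempty V ∧ P.Mem G

/-- `P` does not contain all finite graphs. -/
def Proper (P : GraphProperty) : Prop :=
  ∃ (V : Type) (_ : Finite V) (G : SimpleGraph V), ¬ P.Mem G

/-- Closed under (not necessarily induced) subgraphs; `G ⊑ H` says that `H` has a subgraph
isomorphic to `G`. -/
def Hereditary (P : GraphProperty) : Prop :=
  ∀ {V W : Type} [Finite V] [Finite W] (G : SimpleGraph V) (H : SimpleGraph W),
    G ⊑ H → P.Mem H → P.Mem G

/-- Hereditary, and any two graphs of `P` are subgraphs of a common graph of `P`. -/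
def HereditaryCompositive (P : GraphProperty) : Prop :=
  P.Hereditary ∧
    ∀ {V W : Type} [Finite V] [Finite W] (G : SimpleGraph V) (H : SimpleGraph W),
      P.Mem G → P.Mem H →
        ∃ (U : Type) (_ : Finite U) (K : SimpleGraph U), P.Mem K ∧ G ⊑ K ∧ H ⊑ K

/-- Closed under vertex-disjoint unions. -/
def Additive (P : GraphProperty) : Prop :=
  ∀ {V W : Type} [Finite V] [Finite W] (G : SimpleGraph V) (H : SimpleGraph W),
    P.Mem G → P.Mem H → P.Mem (G ⊕g H)

/-- The product of the properties `Q i`: the graphs whose vertex set has a partition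
`(V i)`, given as the fibres of a map `f`, such that each `G[V i]` is in `Q i`; parts are
allowed to be empty. -/
def prod {ι : Type} (Q : ι → GraphProperty) : GraphProperty where
  Mem {V} _ G := ∃ f : V → ι, ∀ i, (f ⁻¹' {i}).Nonempty → (Q i).Mem (G.induce (f ⁻¹' {i}))
  iso := by
    rintro V W _ _ G H e ⟨f, hf⟩
    refine ⟨f ∘ e.symm, fun i hi => ?_⟩
    obtain ⟨w, hw⟩ := hi
    refine (Q i).iso (G := G.induce (f ⁻¹' {i})) ?_ (hf i ⟨e.symm w, hw⟩)
    exact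
      { toEquiv := e.toEquiv.subtypeEquiv (fun v => by simp)
        map_rel_iff' := by
          intro a b
          exact e.map_rel_iff' }

/-- `G` is `P`-maximal: it is in `P`, but adding any missing edge leads outside `P`. -/
def IsMaximal (P : GraphProperty) {V : Type} [Finite V] (G : SimpleGraph V) : Prop :=
  P.Mem G ∧ ∀ u v : V, u ≠ v → ¬ G.Adj u v → ¬ P.Mem (G ⊔ edge u v)

/-- `c(P)`: the largest `r` such that the complete graph `K_r` is in `P`
(meaningful if `P` is hereditary, has a member and is proper). -/
noncomputable def cliqueNumber (P : GraphProperty) : ℕ :=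
  sSup {r : ℕ | P.Mem (⊤ : SimpleGraph (Fin r))}

/-- `M*(P)`: the `P`-maximal graphs with at least `c(P)` vertices. -/
def IsMaximalStar (P : GraphProperty) {V : Type} [Finite V] (G : SimpleGraph V) : Prop :=
  P.IsMaximal G ∧ P.cliqueNumber ≤ Nat.card V

end GraphProperty

/-- `G` is the join of two non-null graphs, on vertex sets `A` and `Aᶜ`. -/
def GraphDecomposable {V : Type} (G : SimpleGraph V) : Prop :=
  ∃ A : Set V, A.Nonempty ∧ Aᶜ.Nonempty ∧ ∀ u ∈ A, ∀ v ∈ Aᶜ, G.Adj u v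

/-- `S` is the vertex set of an ind-part of `G`, i.e. of an indecomposable non-null graph
occurring in the expression of `G` as a join of such graphs. -/
def IsIndPart {V : Type} (G : SimpleGraph V) (S : Set V) : Prop :=
  S.Nonempty ∧ (∀ u ∈ S, ∀ v ∈ Sᶜ, G.Adj u v) ∧ ¬ GraphDecomposable (G.induce S)

/-- `dc(G)`: the number of ind-parts of `G`. -/
noncomputable def graphDc {V : Type} (G : SimpleGraph V) : ℕ :=
  Nat.card {S : Set V // IsIndPart G S}

namespace GraphProperty

/-- `dc(P)`: the minimum of `dc(G)` over all `G ∈ M*(P)`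
(`M*(P)` is nonempty if `P` is hereditary, has a member and is proper). -/
noncomputable def dc (P : GraphProperty) : ℕ :=
  sInf {k : ℕ | ∃ (V : Type) (_ : Finite V) (G : SimpleGraph V),
    P.IsMaximalStar G ∧ graphDc G = k}

/-- `P` is indecomposable. -/
def Indecomposable (P : GraphProperty) : Prop :=
  P.dc = 1

end GraphProperty

/-!
A hereditary compositive property is the class of finite subgraphs of a single, possibly infinite,
graph `H`, namely of an ultraproduct of its members. By Zorn's lemma `H` can be taken to be
edge-maximal for this. Then every path of `Hᶜ` survives in the complement of each `P`-maximal
graph that extends a large enough finite part of `H`. If `Hᶜ` had fewer than `dc P` components,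
such a maximal graph, containing a clique of order `c(P)`, would have an ind-part that misses the
clique, and a vertex of it would extend the clique. So `H` is a join of `dc P` non-null graphs,
and their ages are the required factors.

Conversely `dc` is superadditive on products: a maximal graph in the product is the join of its
parts, each part is maximal for its factor, and it is large enough to be counted, since otherwise
moving one vertex into a small part would allow one more edge. Since each factor has `dc` at
least 1, in a factorisation into `dc P` factors all of them are indecomposable.

If `P` is additive, it also contains all finite subgraphs of the disjoint union of countably many
copies of `H`. By compactness this union is partitioned according to a given factorisation; putting
each vertex of `H` into the part chosen by almost all of its copies, for an ultrafilter on `ℕ`,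
makes the disjoint union of countably many copies of every part of `H` a graph all of whose finite
subgraphs lie in the corresponding factor.
-/

/-! ### General facts about graphs -/

section Graph

variable {V W ι : Type} {G : SimpleGraph V} {H : SimpleGraph W} {S T : Set V} {u v : V}

theorem induce_isContained_of_subset (G : SimpleGraph V) (h : S ⊆ T) :
    G.induce S ⊑ G.induce T :=
  ⟨(induceHomOfLE G h).toCopy⟩

theorem induce_preimage_isContained (φ : Copy G H) (S : Set W) :
    G.induce (φ ⁻¹' S) ⊑ H.induce S :=
  ⟨⟨⟨fun x => ⟨φ x, x.2⟩, fun h => φ.toHom.map_adj h⟩,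
    fun _ _ h => Subtype.ext (φ.injective (congrArg Subtype.val h))⟩⟩

theorem isContained_induce_of_range_subset (φ : Copy G H) {S : Set W} (hS : Set.range φ ⊆ S) :
    G ⊑ H.induce S :=
  ⟨⟨⟨fun x => ⟨φ x, hS ⟨x, rfl⟩⟩, fun h => φ.toHom.map_adj h⟩,
    fun _ _ h => φ.injective (congrArg Subtype.val h)⟩⟩

theorem induce_union_isContained_sum {A B : Set V} (hAB : ∀ u ∈ A, ∀ v ∈ B, ¬ G.Adj u v) :
    G.induce (A ∪ B) ⊑ G.induce A ⊕g G.induce B := by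
  classical
  let φ : ↥(A ∪ B) → A ⊕ B := fun x =>
    if h : x.1 ∈ A then .inl ⟨x, h⟩ else .inr ⟨x, x.2.resolve_left h⟩
  refine ⟨⟨⟨φ, fun {x y} hxy => ?_⟩, fun x y hxy => ?_⟩⟩
  · have hxy : G.Adj x y := hxy
    by_cases hx : x.1 ∈ A <;> by_cases hy : y.1 ∈ A
    · simpa [φ, hx, hy] using hxy
    · exact (hAB x hx y (y.2.resolve_left hy) hxy).elim
    · exact (hAB y hy x (x.2.resolve_left hx) hxy.symm).elim
    · simpa [φ, hx, hy] using hxy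
  · by_cases hx : x.1 ∈ A <;> by_cases hy : y.1 ∈ A <;> simp_all [φ, Subtype.ext_iff]

theorem induce_sup_edge_le (h : ¬ (u ∈ S ∧ v ∈ S)) : (G ⊔ edge u v).induce S ≤ G.induce S := by
  intro x y hxy
  rw [comap_adj, sup_adj, edge_adj] at hxy
  rcases hxy with hxy | ⟨⟨hx, hy⟩ | ⟨hx, hy⟩, -⟩
  · exact hxy
  · exact (h ⟨hx ▸ x.2, hy ▸ y.2⟩).elim
  · exact (h ⟨hy ▸ y.2, hx ▸ x.2⟩).elim

theorem induce_sup_edge (hu : u ∈ S) (hv : v ∈ S) :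
    (G ⊔ edge u v).induce S = G.induce S ⊔ edge ⟨u, hu⟩ ⟨v, hv⟩ := by
  ext x y
  simp only [comap_adj, sup_adj, edge_adj, Function.Embedding.subtype_apply, Subtype.ext_iff,
    ne_eq]

theorem adj_of_maximal {p : SimpleGraph V → Prop} (hG : Maximal p G) (huv : u ≠ v)
    (h : p (G ⊔ edge u v)) : G.Adj u v :=
  by_contra fun hn => hG.not_prop_of_gt (lt_sup_edge _ _ _ huv hn) h

theorem mem_of_reachable (hS : ∀ u ∈ S, ∀ v ∉ S, ¬ G.Adj u v) (h : G.Reachable u v) (hu : u ∈ S) :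
    v ∈ S := by
  by_contra hv
  obtain ⟨p⟩ := h
  obtain ⟨d, -, hd, hd'⟩ := p.exists_boundary_dart S hu hv
  exact hS _ hd _ hd' d.adj

theorem reachable_induce (hS : ∀ u ∈ S, ∀ v ∉ S, ¬ G.Adj u v) {u v : S} (h : G.Reachable u v) :
    (G.induce S).Reachable u v := by
  have hclosed : ∀ x ∈ Subtype.val '' {y : S | (G.induce S).Reachable u y},
      ∀ y ∉ Subtype.val '' {y : S | (G.induce S).Reachable u y}, ¬ G.Adj x y := by
    rintro _ ⟨x, hx, rfl⟩ y hy hxy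
    have hyS : y ∈ S := by_contra fun h => hS _ x.2 _ h hxy
    exact hy ⟨⟨y, hyS⟩, hx.trans (Adj.reachable hxy), rfl⟩
  obtain ⟨v', hv', h'⟩ := mem_of_reachable hclosed h ⟨u, .refl _, rfl⟩
  rwa [Subtype.ext h'] at hv'

theorem induce_compl (G : SimpleGraph V) (S : Set V) : (G.induce S)ᶜ = Gᶜ.induce S := by
  ext x y
  simp only [compl_adj, comap_adj, Function.Embedding.subtype_apply, ne_eq, Subtype.ext_iff]

theorem adj_of_not_reachable_compl (h : ¬ Gᶜ.Reachable u v) : G.Adj u v := by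
  by_contra hn
  have huv : u ≠ v := by
    rintro rfl
    exact h (.refl _)
  exact h (Adj.reachable ((compl_adj _ _ _).2 ⟨huv, hn⟩))

theorem not_adj_compl_of_mem_fibre {f : V → ι} (hf : ∀ u v, f u ≠ f v → G.Adj u v) (i : ι) :
    ∀ u ∈ f ⁻¹' {i}, ∀ v ∉ f ⁻¹' {i}, ¬ Gᶜ.Adj u v := by
  rintro u rfl v hv huv
  exact ((compl_adj _ _ _).1 huv).2 (hf u v (Ne.symm hv))

end Graph

/-! ### Ind-parts and connected components of the complement -/

section IndPart

variable {V ι : Type} {G : SimpleGraph V}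

theorem graphDecomposable_iff_not_preconnected_compl :
    GraphDecomposable G ↔ ¬ Gᶜ.Preconnected := by
  constructor
  · rintro ⟨A, ⟨a, ha⟩, ⟨b, hb⟩, hA⟩ hconn
    exact hb (mem_of_reachable (fun u hu v hv h => ((compl_adj _ _ _).1 h).2 (hA u hu v hv))
      (hconn a b) ha)
  · intro h
    simp only [Preconnected, not_forall] at h
    obtain ⟨a, b, hab⟩ := h
    exact ⟨{x | Gᶜ.Reachable a x}, ⟨a, .refl _⟩, ⟨b, hab⟩, fun u hu v hv =>
      adj_of_not_reachable_compl fun huv => hv (hu.trans huv)⟩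

theorem isIndPart_iff_exists_supp_eq {S : Set V} :
    IsIndPart G S ↔ ∃ c : Gᶜ.ConnectedComponent, c.supp = S := by
  rw [IsIndPart, graphDecomposable_iff_not_preconnected_compl, not_not, induce_compl]
  constructor
  · rintro ⟨⟨a, ha⟩, hjoin, hconn⟩
    refine ⟨Gᶜ.connectedComponentMk a, Set.Subset.antisymm (fun x hx => ?_) fun x hx => ?_⟩
    · exact mem_of_reachable (fun u hu v hv h => ((compl_adj _ _ _).1 h).2 (hjoin u hu v hv))
        (ConnectedComponent.eq.1 hx).symm ha
    · exact ConnectedComponent.eq.2 ((hconn ⟨x, hx⟩ ⟨a, ha⟩).map (Embedding.induce S).toHom)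
  · rintro ⟨c, rfl⟩
    refine ⟨c.nonempty_supp, fun u hu v hv => ?_, c.connected_toSimpleGraph.preconnected⟩
    exact adj_of_not_reachable_compl fun h => hv ((ConnectedComponent.eq.2 h.symm).trans hu)

theorem graphDc_eq_card_connectedComponent (G : SimpleGraph V) :
    graphDc G = Nat.card Gᶜ.ConnectedComponent := by
  simp only [graphDc, isIndPart_iff_exists_supp_eq]
  exact (Nat.card_congr (Equiv.ofInjective _ ConnectedComponent.supp_injective)).symm

theorem one_le_graphDc [Finite V] [Nonempty V] (G : SimpleGraph V) : 1 ≤ graphDc G := by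
  rw [graphDc_eq_card_connectedComponent]
  exact Nat.card_pos

theorem sum_graphDc_induce_le [Finite V] [Fintype ι] {f : V → ι}
    (hf : ∀ u v, f u ≠ f v → G.Adj u v) : ∑ i, graphDc (G.induce (f ⁻¹' {i})) ≤ graphDc G := by
  simp only [graphDc_eq_card_connectedComponent, induce_compl]
  rw [← Nat.card_sigma]
  refine Nat.card_le_card_of_injective
    (fun p : Σ i, (Gᶜ.induce (f ⁻¹' {i})).ConnectedComponent =>
      p.2.map (Embedding.induce _).toHom) ?_
  rintro ⟨i, c⟩ ⟨j, d⟩ h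
  induction c using ConnectedComponent.ind with | h x
  induction d using ConnectedComponent.ind with | h y
  have hxy : Gᶜ.Reachable x y := ConnectedComponent.eq.1 h
  have hyi : y.1 ∈ f ⁻¹' {i} := mem_of_reachable (not_adj_compl_of_mem_fibre hf i) hxy x.2
  obtain rfl : j = i := y.2.symm.trans hyi
  exact congrArg _ (ConnectedComponent.eq.2
    (reachable_induce (not_adj_compl_of_mem_fibre hf j) hxy))

theorem exists_forall_not_reachable_compl [Finite ι] (w : ι → V) (h : Nat.card ι < graphDc G) :
    ∃ r, ∀ i, ¬ Gᶜ.Reachable (w i) r := by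
  by_contra! hcon
  rw [graphDc_eq_card_connectedComponent] at h
  refine h.not_ge (Nat.card_le_card_of_surjective (fun i => Gᶜ.connectedComponentMk (w i)) ?_)
  intro c
  induction c using ConnectedComponent.ind with | h r
  exact (hcon r).imp fun i hi => ConnectedComponent.eq.2 hi

end IndPart

namespace GraphProperty

variable {P : GraphProperty} {V W : Type} {G : SimpleGraph V}

/-- Properties are ordered by inclusion. -/
instance : PartialOrder GraphProperty where
  le P Q := ∀ ⦃V : Type⦄ [Finite V] (G : SimpleGraph V), P.Mem G → Q.Mem G
  le_refl _ _ _ _ := id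
  le_trans _ _ _ hPQ hQR _ _ G hG := hQR G (hPQ G hG)
  le_antisymm _ _ hPQ hQP :=
    GraphProperty.ext (funext fun _ => funext fun _ => funext fun G =>
      propext ⟨hPQ G, hQP G⟩)

/-! ### Hereditary properties, their clique number and their maximal graphs -/

theorem HasNonnullMember.hasMember (h : P.HasNonnullMember) : P.HasMember := by
  obtain ⟨V, _, G, _, hG⟩ := h
  exact ⟨V, _, G, hG⟩

theorem Hereditary.mem_of_le [Finite V] (hP : P.Hereditary) {G H : SimpleGraph V} (h : G ≤ H)
    (hH : P.Mem H) : P.Mem G :=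
  hP G H (.of_le h) hH

theorem Hereditary.mem_induce_of_subset (hP : P.Hereditary) {S T : Set V} [Finite S] [Finite T]
    (h : S ⊆ T) (hT : P.Mem (G.induce T)) : P.Mem (G.induce S) :=
  hP _ _ (induce_isContained_of_subset G h) hT

theorem Hereditary.mem_of_isEmpty [Finite V] [IsEmpty V] (hP : P.Hereditary) (hne : P.HasMember)
    (G : SimpleGraph V) : P.Mem G := by
  obtain ⟨W, _, H, hH⟩ := hne
  exact hP G H .of_isEmpty hH

theorem Hereditary.mem_of_card_le [Finite V] (hP : P.Hereditary) {n : ℕ}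
    (hn : P.Mem (⊤ : SimpleGraph (Fin n))) (hV : Nat.card V ≤ n) : P.Mem G := by
  let φ : V ↪ Fin n := (Finite.equivFin V).toEmbedding.trans (Fin.castLEEmb hV)
  exact hP _ _ ((IsContained.of_le le_top).trans ⟨(Embedding.completeGraph φ).toCopy⟩) hn

theorem Hereditary.mem_top_of_pairwise_adj [Finite V] (hP : P.Hereditary) (hG : P.Mem G)
    {ι : Type} [Finite ι] {φ : ι → V} (hφ : Pairwise fun a b => G.Adj (φ a) (φ b)) :
    P.Mem (⊤ : SimpleGraph ι) := by
  have hinj : Function.Injective φ := fun a b hab => by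
    by_contra h
    exact (hφ h).ne hab
  exact hP _ _ ⟨⟨⟨φ, fun h => hφ ((top_adj _ _).1 h)⟩, hinj⟩⟩ hG

theorem Hereditary.bddAbove_top (hP : P.Hereditary) (hproper : P.Proper) :
    BddAbove {r : ℕ | P.Mem (⊤ : SimpleGraph (Fin r))} := by
  obtain ⟨V, _, G, hG⟩ := hproper
  refine ⟨Nat.card V, fun r hr => ?_⟩
  by_contra! h
  exact hG (hP.mem_of_card_le hr h.le)

theorem Hereditary.card_le_cliqueNumber [Finite V] (hP : P.Hereditary) (hproper : P.Proper)
    (hG : P.Mem G) {ι : Type} [Finite ι] {φ : ι → V}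
    (hφ : Pairwise fun a b => G.Adj (φ a) (φ b)) : Nat.card ι ≤ P.cliqueNumber :=
  le_csSup (hP.bddAbove_top hproper)
    (P.iso (Iso.completeGraph (Finite.equivFin ι)) (hP.mem_top_of_pairwise_adj hG hφ))

theorem Hereditary.exists_not_adj_of_pairwise_adj [Finite V] (hP : P.Hereditary)
    (hproper : P.Proper) (hG : P.Mem G) {φ : Fin P.cliqueNumber → V}
    (hφ : Pairwise fun a b => G.Adj (φ a) (φ b)) (v : V) : ∃ a, ¬ G.Adj (φ a) v := by
  by_contra! hadj
  let ψ : Option (Fin P.cliqueNumber) → V := fun o => o.elim v φ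
  have hψ : Pairwise fun a b => G.Adj (ψ a) (ψ b) := by
    rintro (_ | a) (_ | b) hab
    · exact (hab rfl).elim
    · exact (hadj b).symm
    · exact hadj a
    · exact hφ fun e => hab (congrArg some e)
  simpa using hP.card_le_cliqueNumber hproper hG hψ

theorem Hereditary.mem_top_cliqueNumber (hP : P.Hereditary) (hne : P.HasMember)
    (hproper : P.Proper) : P.Mem (⊤ : SimpleGraph (Fin P.cliqueNumber)) :=
  Nat.sSup_mem ⟨0, hP.mem_of_isEmpty hne _⟩ (hP.bddAbove_top hproper)

theorem Hereditary.mem_of_card_le_cliqueNumber [Finite V] (hP : P.Hereditary) (hne : P.HasMember)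
    (hproper : P.Proper) (hV : Nat.card V ≤ P.cliqueNumber) : P.Mem G :=
  hP.mem_of_card_le (hP.mem_top_cliqueNumber hne hproper) hV

theorem Hereditary.exists_not_adj_of_cliqueNumber_lt_card [Finite V] (hP : P.Hereditary)
    (hproper : P.Proper) (hG : P.Mem G) (hV : P.cliqueNumber < Nat.card V) :
    ∃ u v, u ≠ v ∧ ¬ G.Adj u v := by
  by_contra! h
  exact hV.not_ge (hP.card_le_cliqueNumber hproper hG (φ := id) fun u v => h u v)

theorem Hereditary.one_le_cliqueNumber (hP : P.Hereditary) (hne : P.HasNonnullMember)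
    (hproper : P.Proper) : 1 ≤ P.cliqueNumber := by
  obtain ⟨V, _, G, ⟨v⟩, hG⟩ := hne
  simpa using hP.card_le_cliqueNumber hproper hG (φ := fun _ : Unit => v)
    fun a b h => (h (Subsingleton.elim a b)).elim

theorem isMaximal_of_maximal [Finite V] (hG : Maximal (fun K : SimpleGraph V => P.Mem K) G) :
    P.IsMaximal G :=
  ⟨hG.prop, fun _ _ huv hadj h => hadj (adj_of_maximal hG huv h)⟩

theorem exists_le_isMaximal [Finite V] (hG : P.Mem G) : ∃ K, G ≤ K ∧ P.IsMaximal K := by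
  obtain ⟨K, hle, hK⟩ := Finite.exists_le_maximal (p := fun K : SimpleGraph V => P.Mem K) hG
  exact ⟨K, hle, isMaximal_of_maximal hK⟩

theorem Hereditary.isMaximalStar_top (hP : P.Hereditary) (hne : P.HasMember)
    (hproper : P.Proper) : P.IsMaximalStar (⊤ : SimpleGraph (Fin P.cliqueNumber)) :=
  ⟨⟨hP.mem_top_cliqueNumber hne hproper, fun _ _ huv h => (h huv).elim⟩, by simp⟩

theorem Hereditary.exists_graphDc_eq_dc (hP : P.Hereditary) (hne : P.HasMember)
    (hproper : P.Proper) :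
    ∃ (V : Type) (_ : Finite V) (G : SimpleGraph V), P.IsMaximalStar G ∧ graphDc G = P.dc :=
  Nat.sInf_mem
    (s := {k : ℕ | ∃ (V : Type) (_ : Finite V) (G : SimpleGraph V),
      P.IsMaximalStar G ∧ graphDc G = k})
    ⟨_, _, _, _, hP.isMaximalStar_top hne hproper, rfl⟩

theorem IsMaximalStar.dc_le [Finite V] (hG : P.IsMaximalStar G) : P.dc ≤ graphDc G :=
  Nat.sInf_le ⟨V, _, G, hG, rfl⟩

theorem Hereditary.one_le_dc (hP : P.Hereditary) (hne : P.HasNonnullMember)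
    (hproper : P.Proper) : 1 ≤ P.dc := by
  obtain ⟨V, _, G, hG, hdc⟩ := hP.exists_graphDc_eq_dc hne.hasMember hproper
  have : Nonempty V :=
    (Nat.card_pos_iff.1 ((hP.one_le_cliqueNumber hne hproper).trans hG.2)).1
  exact hdc ▸ one_le_graphDc G

/-! ### Products -/

section Product

variable {ι : Type} {Q R : ι → GraphProperty} {f : V → ι}

theorem prod_mono (h : Q ≤ R) : prod Q ≤ prod R :=
  fun _ _ _ ⟨f, hf⟩ => ⟨f, fun i hi => h i _ (hf i hi)⟩

theorem le_prod (Q : ι → GraphProperty) (i : ι) : Q i ≤ prod Q := by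
  intro V _ G hG
  refine ⟨fun _ => i, fun j ⟨_, hv⟩ => ?_⟩
  obtain rfl : i = j := hv
  exact (Q i).iso (G := G) ⟨(Equiv.Set.univ V).symm.trans (Equiv.setCongr (by simp)), .rfl⟩ hG

theorem proper_of_prod (h : (prod Q).Proper) (i : ι) : (Q i).Proper := by
  obtain ⟨V, _, G, hG⟩ := h
  exact ⟨V, _, G, fun hi => hG (le_prod Q i G hi)⟩

theorem prod_hasMember (Q : ι → GraphProperty) : (prod Q).HasMember :=
  ⟨Empty, inferInstance, ⊥, isEmptyElim, fun _ ⟨x, _⟩ => x.elim⟩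

theorem prod_hereditary (hQ : ∀ i, (Q i).Hereditary) : (prod Q).Hereditary := by
  rintro V W _ _ G H ⟨φ⟩ ⟨f, hf⟩
  exact ⟨f ∘ φ, fun i ⟨v, hv⟩ =>
    hQ i _ _ (induce_preimage_isContained φ (f ⁻¹' {i})) (hf i ⟨φ v, hv⟩)⟩

theorem mem_prod_iff [Finite V] (hQ : ∀ i, (Q i).Hereditary) (hne : ∀ i, (Q i).HasMember) :
    (prod Q).Mem G ↔ ∃ f : V → ι, ∀ i, (Q i).Mem (G.induce (f ⁻¹' {i})) := by
  refine ⟨fun ⟨f, hf⟩ => ⟨f, fun i => ?_⟩, fun ⟨f, hf⟩ => ⟨f, fun i _ => hf i⟩⟩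
  obtain h | h := (f ⁻¹' {i}).eq_empty_or_nonempty
  · have : IsEmpty (f ⁻¹' {i}) := Set.isEmpty_coe_sort.2 h
    exact Hereditary.mem_of_isEmpty (hQ i) (hne i) _
  · exact hf i h

theorem sum_cliqueNumber_le [Fintype ι] (hQ : ∀ i, (Q i).Hereditary)
    (hne : ∀ i, (Q i).HasMember) (hproper : (prod Q).Proper) :
    ∑ i, (Q i).cliqueNumber ≤ (prod Q).cliqueNumber := by
  have h : (prod Q).Mem (⊤ : SimpleGraph (Σ i, Fin (Q i).cliqueNumber)) := by
    refine (mem_prod_iff hQ hne).2 ⟨Sigma.fst, fun i => ?_⟩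
    refine Hereditary.mem_of_card_le_cliqueNumber (hQ i) (hne i) (proper_of_prod hproper i) ?_
    let e : (Sigma.fst ⁻¹' {i} : Set (Σ i, Fin (Q i).cliqueNumber)) ≃ Fin (Q i).cliqueNumber :=
      Equiv.sigmaSubtype i
    exact (Nat.card_congr e).trans_le (Nat.card_fin _).le
  simpa using Hereditary.card_le_cliqueNumber (prod_hereditary hQ) hproper h (φ := id) fun _ _ => id

theorem IsMaximal.adj_of_ne [Finite V] (hQ : ∀ i, (Q i).Hereditary) (hG : (prod Q).IsMaximal G)
    (hf : ∀ i, (Q i).Mem (G.induce (f ⁻¹' {i}))) {u v : V} (huv : f u ≠ f v) : G.Adj u v := by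
  by_contra h
  refine hG.2 u v (fun e => huv (congrArg f e)) h ⟨f, fun i _ => ?_⟩
  have hnot : ¬ (u ∈ f ⁻¹' {i} ∧ v ∈ f ⁻¹' {i}) := fun ⟨hu, hv⟩ => huv (hu.trans hv.symm)
  exact Hereditary.mem_of_le (hQ i) (induce_sup_edge_le hnot) (hf i)

theorem IsMaximal.induce_fibre [Finite V] (hQ : ∀ i, (Q i).Hereditary)
    (hG : (prod Q).IsMaximal G) (hf : ∀ i, (Q i).Mem (G.induce (f ⁻¹' {i}))) (i : ι) :
    (Q i).IsMaximal (G.induce (f ⁻¹' {i})) := by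
  refine ⟨hf i, fun u v huv hadj hmem => ?_⟩
  refine hG.2 u v (fun e => huv (Subtype.ext e)) hadj ⟨f, fun j _ => ?_⟩
  obtain rfl | hij := eq_or_ne i j
  · rwa [induce_sup_edge u.2 v.2]
  · have hu : u.1 ∉ f ⁻¹' {j} := fun hu => hij (u.2.symm.trans hu)
    exact Hereditary.mem_of_le (hQ j) (induce_sup_edge_le fun h => hu h.1) (hf j)

theorem exists_cliqueNumber_lt_card_fibre [Finite V] [Finite ι] (hQ : ∀ i, (Q i).Hereditary)
    (hne : ∀ i, (Q i).HasMember) (hproper : (prod Q).Proper)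
    (hV : (prod Q).cliqueNumber ≤ Nat.card V) (f : V → ι) {i : ι}
    (hi : Nat.card (f ⁻¹' {i}) < (Q i).cliqueNumber) :
    ∃ j, (Q j).cliqueNumber < Nat.card (f ⁻¹' {j}) := by
  by_contra! h
  have := Fintype.ofFinite ι
  have hlt : Nat.card V < (prod Q).cliqueNumber := calc
    Nat.card V = ∑ j, Nat.card (f ⁻¹' {j}) := by
      rw [← Nat.card_sigma]
      exact Nat.card_congr (Equiv.sigmaFiberEquiv f).symm
    _ < ∑ j, (Q j).cliqueNumber := Finset.sum_lt_sum (fun j _ => h j) ⟨i, Finset.mem_univ i, hi⟩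
    _ ≤ (prod Q).cliqueNumber := sum_cliqueNumber_le hQ hne hproper
  exact hlt.not_ge hV

theorem mem_prod_sup_edge [Finite V] (hQ : ∀ i, (Q i).Hereditary)
    (hne : ∀ i, (Q i).HasMember) (hproper : (prod Q).Proper)
    (hf : ∀ i, (Q i).Mem (G.induce (f ⁻¹' {i}))) {i : ι}
    (hi : Nat.card (f ⁻¹' {i}) < (Q i).cliqueNumber) (u v : V) :
    (prod Q).Mem (G ⊔ edge u v) := by
  classical
  refine ⟨Function.update f v i, fun j _ => ?_⟩
  obtain rfl | hij := eq_or_ne i j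
  · refine Hereditary.mem_of_card_le_cliqueNumber (hQ i) (hne i) (proper_of_prod hproper i) ?_
    have hsub : Function.update f v i ⁻¹' {i} ⊆ insert v (f ⁻¹' {i}) := by
      intro x hx
      obtain rfl | hxv := eq_or_ne x v
      · exact Set.mem_insert _ _
      · exact Or.inr (by simpa [Function.update_of_ne hxv] using hx)
    calc
      _ ≤ (insert v (f ⁻¹' {i})).ncard := Set.ncard_le_ncard hsub
      _ ≤ (f ⁻¹' {i}).ncard + 1 := Set.ncard_insert_le _ _
      _ ≤ (Q i).cliqueNumber := hi
  · have hv : v ∉ Function.update f v i ⁻¹' {j} := by simpa using hij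
    have hsub : Function.update f v i ⁻¹' {j} ⊆ f ⁻¹' {j} := by
      intro x hx
      have hxv : x ≠ v := fun e => hv (e ▸ hx)
      simpa [Function.update_of_ne hxv] using hx
    exact Hereditary.mem_of_le (hQ j) (induce_sup_edge_le fun h => hv h.2)
      (Hereditary.mem_induce_of_subset (hQ j) hsub (hf j))

theorem IsMaximalStar.cliqueNumber_le_card_fibre [Finite V] [Finite ι]
    (hQ : ∀ i, (Q i).Hereditary) (hne : ∀ i, (Q i).HasMember) (hproper : (prod Q).Proper)
    (hG : (prod Q).IsMaximalStar G) (hf : ∀ i, (Q i).Mem (G.induce (f ⁻¹' {i}))) (i : ι) :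
    (Q i).cliqueNumber ≤ Nat.card (f ⁻¹' {i}) := by
  by_contra! hi
  obtain ⟨j, hj⟩ := exists_cliqueNumber_lt_card_fibre hQ hne hproper hG.2 f hi
  obtain ⟨u, v, huv, hadj⟩ :=
    Hereditary.exists_not_adj_of_cliqueNumber_lt_card (hQ j) (proper_of_prod hproper j) (hf j) hj
  exact hG.1.2 u v (fun e => huv (Subtype.ext e)) hadj
    (mem_prod_sup_edge hQ hne hproper hf hi u v)

theorem sum_dc_le_dc_prod [Fintype ι] (hQ : ∀ i, (Q i).Hereditary)
    (hne : ∀ i, (Q i).HasMember) (hproper : (prod Q).Proper) :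
    ∑ i, (Q i).dc ≤ (prod Q).dc := by
  obtain ⟨V, _, G, hG, hdc⟩ :=
    Hereditary.exists_graphDc_eq_dc (prod_hereditary hQ) (prod_hasMember Q) hproper
  obtain ⟨f, hf⟩ := (mem_prod_iff hQ hne).1 hG.1.1
  have hstar : ∀ i, (Q i).IsMaximalStar (G.induce (f ⁻¹' {i})) := fun i =>
    ⟨hG.1.induce_fibre hQ hf i, hG.cliqueNumber_le_card_fibre hQ hne hproper hf i⟩
  calc
    ∑ i, (Q i).dc ≤ ∑ i, graphDc (G.induce (f ⁻¹' {i})) :=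
      Finset.sum_le_sum fun i _ => (hstar i).dc_le
    _ ≤ graphDc G := sum_graphDc_induce_le fun _ _ => hG.1.adj_of_ne hQ hf
    _ = (prod Q).dc := hdc

theorem indecomposable_of_dc_prod_le_card [Finite ι] (hQ : ∀ i, (Q i).Hereditary)
    (hne : ∀ i, (Q i).HasNonnullMember) (hproper : (prod Q).Proper)
    (hdc : (prod Q).dc ≤ Nat.card ι) (i : ι) : (Q i).Indecomposable := by
  have := Fintype.ofFinite ι
  have hone : ∀ i ∈ Finset.univ, 1 ≤ (Q i).dc := fun i _ =>
    Hereditary.one_le_dc (hQ i) (hne i) (proper_of_prod hproper i)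
  have hsum : ∑ i, (Q i).dc ≤ ∑ _i : ι, 1 := by
    simpa [← Nat.card_eq_fintype_card] using
      (sum_dc_le_dc_prod hQ (fun i => (hne i).hasMember) hproper).trans hdc
  exact ((Finset.sum_eq_sum_iff_of_le hone).1
    (le_antisymm (Finset.sum_le_sum hone) hsum) i (Finset.mem_univ i)).symm

end Product

/-! ### Ages -/

section Age

variable {H : SimpleGraph V} {K : SimpleGraph W}

/-- The class of finite graphs contained in a graph `H`, which may be infinite. Every hereditary
compositive property is of this form. -/
def age (H : SimpleGraph V) : GraphProperty where
  Mem G := G ⊑ H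
  iso e h := IsContained.trans ⟨e.symm.toCopy⟩ h

theorem age_mono (h : H ⊑ K) : age H ≤ age K :=
  fun _ _ _ hG => IsContained.trans hG h

theorem age_hereditary (H : SimpleGraph V) : (age H).Hereditary :=
  fun _ _ => IsContained.trans

theorem mem_age_induce (H : SimpleGraph V) (S : Set V) [Finite S] : (age H).Mem (H.induce S) :=
  ⟨Copy.induce H S⟩

theorem age_hereditaryCompositive (H : SimpleGraph V) : (age H).HereditaryCompositive := by
  refine ⟨age_hereditary H, ?_⟩
  rintro A B _ _ G K ⟨φ⟩ ⟨ψ⟩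
  exact ⟨(Set.range φ ∪ Set.range ψ : Set V), inferInstance, H.induce _, mem_age_induce H _,
    isContained_induce_of_range_subset φ Set.subset_union_left,
    isContained_induce_of_range_subset ψ Set.subset_union_right⟩

theorem age_hasMember (H : SimpleGraph V) : (age H).HasMember :=
  ⟨Empty, inferInstance, ⊥, .of_isEmpty⟩

theorem age_hasNonnullMember [Nonempty V] (H : SimpleGraph V) : (age H).HasNonnullMember := by
  obtain ⟨v⟩ := ‹Nonempty V›
  exact ⟨({v} : Set V), inferInstance, _, inferInstance, mem_age_induce H _⟩

theorem age_le_iff (hP : P.Hereditary) :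
    age H ≤ P ↔ ∀ T : Finset V, P.Mem (H.induce (T : Set V)) := by
  refine ⟨fun h T => h _ (mem_age_induce H _), fun h W _ G ⟨φ⟩ => ?_⟩
  refine hP _ _ (isContained_induce_of_range_subset φ ?_) (h (Set.finite_range φ).toFinset)
  rw [Set.Finite.coe_toFinset]

theorem age_le_prod {ι : Type} {Q : ι → GraphProperty} (f : V → ι)
    (hf : ∀ i, age (H.induce (f ⁻¹' {i})) ≤ Q i) : age H ≤ prod Q :=
  fun _ _ _ ⟨φ⟩ => ⟨f ∘ φ, fun i _ => hf i _ (induce_preimage_isContained φ (f ⁻¹' {i}))⟩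

theorem age_eq_prod {ι : Type} {f : V → ι} (hf : ∀ u v, f u ≠ f v → H.Adj u v) :
    age H = prod fun i => age (H.induce (f ⁻¹' {i})) := by
  refine le_antisymm (age_le_prod f fun i => le_rfl) ?_
  rintro W _ G ⟨g, hg⟩
  have φ : ∀ i, (g ⁻¹' {i}).Nonempty →
      Copy (G.induce (g ⁻¹' {i})) (H.induce (f ⁻¹' {i})) := fun i hi => (hg i hi).some
  let F : W → V := fun w => φ (g w) ⟨w, rfl⟩ ⟨w, rfl⟩
  have hF : ∀ w i (h : g w = i), F w = φ i ⟨w, h⟩ ⟨w, h⟩ := by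
    rintro w i rfl
    rfl
  have hfF : ∀ w, f (F w) = g w := fun w => (φ (g w) ⟨w, rfl⟩ ⟨w, rfl⟩).2
  refine ⟨⟨⟨F, fun {x y} hxy => ?_⟩, fun x y (hxy : F x = F y) => ?_⟩⟩
  · by_cases h : g x = g y
    · rw [hF x _ h, hF y _ rfl]
      exact (φ (g y) ⟨y, rfl⟩).toHom.map_adj (v := ⟨x, h⟩) (w := ⟨y, rfl⟩) hxy
    · exact hf _ _ (by rwa [hfF, hfF])
  · have h : g x = g y := by rw [← hfF, ← hfF, hxy]
    rw [hF x _ h, hF y _ rfl] at hxy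
    exact congrArg Subtype.val ((φ (g y) ⟨y, rfl⟩).injective (Subtype.ext hxy))

end Age

/-! ### Ultraproducts -/

section Ultraproduct

variable {I : Type} {V : I → Type} (G : ∀ i, SimpleGraph (V i)) (U : Ultrafilter I)

/-- The ultraproduct of the graphs `G i` along `U`. Adjacency is read off the representatives
chosen by `Quotient.out`; by the filter axioms it does not depend on them. -/
def ultraproduct : SimpleGraph ((U : Filter I).Product V) where
  Adj x y := ∀ᶠ i in (U : Filter I), (G i).Adj (x.out i) (y.out i)
  symm := ⟨fun _ _ h => h.mono fun _ h => h.symm⟩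
  loopless := ⟨fun _ h => by
    obtain ⟨i, hi⟩ := h.exists
    exact hi.ne rfl⟩

variable {G U}

theorem ultraproduct_adj_mk {x y : ∀ i, V i} :
    (ultraproduct G U).Adj (Quotient.mk _ x) (Quotient.mk _ y) ↔
      ∀ᶠ i in (U : Filter I), (G i).Adj (x i) (y i) := by
  have hout : ∀ z : ∀ i, V i, ∀ᶠ i in (U : Filter I),
      Quotient.out (Quotient.mk ((U : Filter I).productSetoid V) z) i = z i :=
    fun z => Quotient.mk_out (s := (U : Filter I).productSetoid V) z
  refine Filter.eventually_congr ?_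
  filter_upwards [hout x, hout y] with i hx hy
  rw [hx, hy]

theorem eventually_isContained_of_isContained_ultraproduct {W : Type} [Finite W]
    {K : SimpleGraph W} (h : K ⊑ ultraproduct G U) : ∀ᶠ i in (U : Filter I), K ⊑ G i := by
  obtain ⟨φ⟩ := h
  have hadj : ∀ᶠ i in (U : Filter I), ∀ p : {p : W × W // K.Adj p.1 p.2},
      (G i).Adj ((φ p.1.1).out i) ((φ p.1.2).out i) :=
    Filter.eventually_all.2 fun p => φ.toHom.map_adj p.2
  have hinj : ∀ᶠ i in (U : Filter I), ∀ p : {p : W × W // p.1 ≠ p.2},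
      (φ p.1.1).out i ≠ (φ p.1.2).out i := by
    refine Filter.eventually_all.2 fun p => Ultrafilter.eventually_not.2 fun h => p.2 ?_
    exact φ.injective (Quotient.out_equiv_out.1 h)
  filter_upwards [hadj, hinj] with i hadj hinj
  refine ⟨⟨⟨fun a => (φ a).out i, fun {a b} hab => hadj ⟨(a, b), hab⟩⟩, fun a b hab => ?_⟩⟩
  by_contra hne
  exact hinj ⟨(a, b), hne⟩ hab

theorem isContained_ultraproduct [∀ i, Nonempty (V i)] {W : Type} {K : SimpleGraph W}
    (h : ∀ᶠ i in (U : Filter I), K ⊑ G i) : K ⊑ ultraproduct G U := by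
  classical
  let F : W → ∀ i, V i := fun w i =>
    if hi : K ⊑ G i then hi.some w else Classical.arbitrary _
  have hF : ∀ i (hi : K ⊑ G i) w, F w i = hi.some w := fun i hi w => dif_pos hi
  refine ⟨⟨⟨fun w => Quotient.mk _ (F w), fun hab => ultraproduct_adj_mk.2 ?_⟩, fun a b hab => ?_⟩⟩
  · filter_upwards [h] with i hi
    rw [hF i hi, hF i hi]
    exact hi.some.toHom.map_adj hab
  · have hab' : ∀ᶠ i in (U : Filter I), F a i = F b i := Quotient.exact hab
    obtain ⟨i, hi, hi'⟩ := (h.and hab').exists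
    rw [hF i hi, hF i hi] at hi'
    exact hi.some.injective hi'

end Ultraproduct

/-- The non-null members of `P` up to isomorphism, preordered by containment: the index set of
the ultraproduct whose age is `P`. -/
structure NonnullMember (P : GraphProperty) where
  /-- The graph has `pred + 1` vertices. -/
  pred : ℕ
  graph : SimpleGraph (Fin (pred + 1))
  mem : P.Mem graph

instance (P : GraphProperty) : Preorder P.NonnullMember where
  le i j := i.graph ⊑ j.graph
  le_refl _ := .rfl
  le_trans _ _ _ := .trans

theorem exists_nonnullMember_iso [Finite V] [Nonempty V] (hG : P.Mem G) :
    ∃ i : P.NonnullMember, Nonempty (G ≃g i.graph) := by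
  obtain ⟨n, hn⟩ : ∃ n, Nat.card V = n + 1 := Nat.exists_eq_succ_of_ne_zero Nat.card_pos.ne'
  let e : V ≃ Fin (n + 1) := Finite.equivFinOfCardEq hn
  exact ⟨⟨n, G.map e.toEmbedding, P.iso (Iso.map e G) hG⟩, ⟨Iso.map e G⟩⟩

theorem HereditaryCompositive.isDirectedOrder_nonnullMember (hP : P.HereditaryCompositive) :
    IsDirectedOrder P.NonnullMember := by
  refine ⟨fun i j => ?_⟩
  obtain ⟨U, _, K, hK, hi, hj⟩ := hP.2 _ _ i.mem j.mem
  have : Nonempty U := ⟨hi.some 0⟩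
  obtain ⟨k, ⟨e⟩⟩ := exists_nonnullMember_iso hK
  exact ⟨k, hi.trans ⟨e.toCopy⟩, hj.trans ⟨e.toCopy⟩⟩

theorem HereditaryCompositive.exists_eq_age (hP : P.HereditaryCompositive) (hne : P.HasMember) :
    ∃ (V : Type) (H : SimpleGraph V), P = age H := by
  have := hP.isDirectedOrder_nonnullMember
  obtain hnull | hnonnull := isEmpty_or_nonempty P.NonnullMember
  · refine ⟨Empty, ⊥, le_antisymm ?_ ?_⟩
    · intro W _ K hK
      have : IsEmpty W := not_nonempty_iff.1 fun _ =>
        (exists_nonnullMember_iso hK).elim fun i _ => hnull.false i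
      exact IsContained.of_isEmpty
    · rintro W _ K ⟨φ⟩
      have : IsEmpty W := φ.toHom.toFun.isEmpty
      exact Hereditary.mem_of_isEmpty hP.1 hne K
  · let U : Ultrafilter P.NonnullMember := Ultrafilter.of Filter.atTop
    refine ⟨_, ultraproduct NonnullMember.graph U, le_antisymm ?_ ?_⟩
    · intro W _ K hK
      obtain _ | _ := isEmpty_or_nonempty W
      · exact IsContained.of_isEmpty
      · obtain ⟨i, ⟨e⟩⟩ := exists_nonnullMember_iso hK
        refine isContained_ultraproduct ?_
        filter_upwards [Ultrafilter.of_le _ (Filter.eventually_ge_atTop i)] with j hj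
        exact IsContained.trans ⟨e.toCopy⟩ hj
    · intro W _ K hK
      obtain ⟨i, hi⟩ := (eventually_isContained_of_isContained_ultraproduct hK).exists
      exact hP.1 _ _ hi i.mem

/-! ### Edge-maximal graphs with a given age -/

section EdgeMaximal

variable {H : SimpleGraph V} {u v : V}

theorem exists_isContained_of_isContained_sSup [Finite W] {G : SimpleGraph W}
    {c : Set (SimpleGraph V)} (hc : DirectedOn (· ≤ ·) c) (hne : c.Nonempty) (h : G ⊑ sSup c) :
    ∃ K ∈ c, G ⊑ K := by
  obtain ⟨φ⟩ := h
  have hedge : ∀ e : {e : W × W // G.Adj e.1 e.2}, ∃ L : c, L.1.Adj (φ e.1.1) (φ e.1.2) := by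
    intro e
    obtain ⟨L, hL, hadj⟩ := sSup_adj.1 (φ.toHom.map_adj e.2)
    exact ⟨⟨L, hL⟩, hadj⟩
  choose L hL using hedge
  have : Nonempty c := hne.to_subtype
  have hdir : Directed (· ≤ ·) ((↑) : c → SimpleGraph V) := hc.directed_val
  obtain ⟨K, hK⟩ := hdir.finite_le L
  exact ⟨K, K.2, ⟨⟨⟨φ, fun {a b} hab => hK ⟨(a, b), hab⟩ (hL ⟨(a, b), hab⟩)⟩, φ.injective⟩⟩⟩

theorem exists_le_maximal_age_le (h : age H ≤ P) :
    ∃ K, H ≤ K ∧ Maximal (fun K : SimpleGraph V => age K ≤ P) K := by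
  refine zorn_le_nonempty₀ {K : SimpleGraph V | age K ≤ P} (fun c hc hchain K hK => ?_) H h
  refine ⟨sSup c, fun W _ G hG => ?_, fun _ => le_sSup⟩
  obtain ⟨L, hL, hGL⟩ := exists_isContained_of_isContained_sSup hchain.directedOn ⟨K, hK⟩ hG
  exact hc hL G hGL

theorem eventually_adj_compl (hP : P.Hereditary)
    (hH : Maximal (fun K : SimpleGraph V => age K ≤ P) H) (huv : Hᶜ.Adj u v) :
    ∀ᶠ T : Finset V in Filter.atTop, ∀ K : SimpleGraph (T : Set V),
      H.induce (T : Set V) ≤ K → P.Mem K → ∀ hu hv, Kᶜ.Adj ⟨u, hu⟩ ⟨v, hv⟩ := by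
  obtain ⟨hne, hadj⟩ := (compl_adj _ _ _).1 huv
  have hnot : ¬ age (H ⊔ edge u v) ≤ P := fun h => hadj (adj_of_maximal hH hne h)
  obtain ⟨T₀, hT₀⟩ := not_forall.1 (mt (age_le_iff hP).2 hnot)
  filter_upwards [Filter.eventually_ge_atTop T₀] with T hT K hK hPK hu hv
  refine (compl_adj _ _ _).2 ⟨fun e => hne (congrArg Subtype.val e), fun hKuv => hT₀ ?_⟩
  refine hP.mem_induce_of_subset (Finset.coe_subset.2 hT) (hP.mem_of_le ?_ hPK)
  rw [induce_sup_edge hu hv]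
  exact sup_le hK ((edge_le_iff K).2 (Or.inr hKuv))

theorem eventually_reachable_compl (hP : P.Hereditary)
    (hH : Maximal (fun K : SimpleGraph V => age K ≤ P) H) (huv : Hᶜ.Reachable u v) :
    ∀ᶠ T : Finset V in Filter.atTop, ∀ K : SimpleGraph (T : Set V),
      H.induce (T : Set V) ≤ K → P.Mem K → ∀ hu hv, Kᶜ.Reachable ⟨u, hu⟩ ⟨v, hv⟩ := by
  rw [reachable_iff_reflTransGen] at huv
  induction huv with
  | refl => exact .of_forall fun _ _ _ _ _ _ => .refl _
  | @tail y z _ hyz ih =>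
    filter_upwards [ih, eventually_adj_compl hP hH hyz, Filter.eventually_ge_atTop {y}]
      with T huy hyz hyT K hK hPK hu hz
    have hy : y ∈ (T : Set V) := Finset.singleton_subset_iff.1 hyT
    exact (huy K hK hPK hu hy).trans (hyz K hK hPK hy hz).reachable

theorem dc_age_le_card_of_reachable {ι : Type} [Finite ι] (hproper : (age H).Proper)
    (hH : Maximal (fun K : SimpleGraph V => age K ≤ age H) H) {w : ι → V}
    (hw : ∀ v, ∃ i, Hᶜ.Reachable (w i) v) : (age H).dc ≤ Nat.card ι := by
  have hP : (age H).Hereditary := age_hereditary H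
  obtain ⟨χ⟩ := hP.mem_top_cliqueNumber (age_hasMember H) hproper
  choose i hi using fun a => hw (χ a)
  have hmem : ∀ v, ∀ᶠ T : Finset V in Filter.atTop, v ∈ T := fun v =>
    (Filter.eventually_ge_atTop {v}).mono fun _ => Finset.singleton_subset_iff.1
  obtain ⟨T, ⟨hwT, hχT⟩, hreach⟩ := (((Filter.eventually_all.2 fun i => hmem (w i)).and
    (Filter.eventually_all.2 fun a => hmem (χ a))).and
    (Filter.eventually_all.2 fun a => eventually_reachable_compl hP hH (hi a))).exists
  obtain ⟨K, hHK, hK⟩ := exists_le_isMaximal (mem_age_induce H (T : Set V))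
  let χT : Fin (age H).cliqueNumber → (T : Set V) := fun a => ⟨χ a, hχT a⟩
  have hclique : Pairwise fun a b => K.Adj (χT a) (χT b) := fun a b hab =>
    hHK (χ.toHom.map_adj ((top_adj a b).2 hab))
  have hcard : (age H).cliqueNumber ≤ Nat.card (T : Set V) := by
    simpa using Nat.card_le_card_of_injective χT
      fun a b hab => χ.injective (congrArg Subtype.val hab)
  by_contra! hlt
  obtain ⟨r, hr⟩ := exists_forall_not_reachable_compl
    (fun i => (⟨w i, hwT i⟩ : (T : Set V))) (hlt.trans_le (IsMaximalStar.dc_le ⟨hK, hcard⟩))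
  obtain ⟨a, ha⟩ := hP.exists_not_adj_of_pairwise_adj hproper hK.1 hclique r
  exact ha (adj_of_not_reachable_compl fun h =>
    hr (i a) ((hreach a K hHK hK.1 (hwT (i a)) (hχT a)).trans h))

theorem dc_age_le_card_connectedComponent (hproper : (age H).Proper)
    (hH : Maximal (fun K : SimpleGraph V => age K ≤ age H) H) :
    ((age H).dc : ℕ∞) ≤ ENat.card Hᶜ.ConnectedComponent := by
  obtain _ | _ := finite_or_infinite Hᶜ.ConnectedComponent
  · rw [ENat.card_eq_coe_natCard, Nat.cast_le]
    exact dc_age_le_card_of_reachable hproper hH (w := Quot.out) fun v =>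
      ⟨Hᶜ.connectedComponentMk v, ConnectedComponent.eq.1 (Quot.out_eq _)⟩
  · simp

theorem exists_surjective_fin_of_le_card {α : Type} {n : ℕ} (hn : (n : ℕ∞) ≤ ENat.card α)
    (hα : Nonempty α → n ≠ 0) : ∃ g : α → Fin n, Function.Surjective g := by
  have hle : Cardinal.mk (Fin n) ≤ Cardinal.mk α := by
    rw [Cardinal.mk_fin]
    exact Cardinal.natCast_le_toENat.1 hn
  obtain ⟨e⟩ := hle
  obtain _ | h := isEmpty_or_nonempty α
  · exact ⟨isEmptyElim, fun i => isEmptyElim (e i)⟩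
  · have : NeZero n := ⟨hα h⟩
    exact ⟨Function.invFun e, Function.invFun_surjective e.injective⟩

theorem HereditaryCompositive.exists_eq_prod (hP : P.HereditaryCompositive) (hne : P.HasMember)
    (hproper : P.Proper) : ∃ Q : Fin P.dc → GraphProperty, P = prod Q ∧
      ∀ i, (Q i).HereditaryCompositive ∧ (Q i).HasNonnullMember := by
  obtain ⟨V, H₀, hH₀⟩ := hP.exists_eq_age hne
  obtain ⟨H, hle, hmax⟩ := exists_le_maximal_age_le hH₀.ge
  obtain rfl : P = age H := le_antisymm (hH₀.le.trans (age_mono (.of_le hle))) hmax.prop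
  obtain ⟨g, hg⟩ := exists_surjective_fin_of_le_card
    (dc_age_le_card_connectedComponent hproper hmax) fun ⟨c⟩ =>
      have : Nonempty V := ⟨c.out⟩
      Nat.one_le_iff_ne_zero.1
        (Hereditary.one_le_dc (age_hereditary H) (age_hasNonnullMember H) hproper)
  let f : V → Fin (age H).dc := g ∘ Hᶜ.connectedComponentMk
  have hf : ∀ u v, f u ≠ f v → H.Adj u v := fun u v huv =>
    adj_of_not_reachable_compl fun h => huv (congrArg g (ConnectedComponent.eq.2 h))
  refine ⟨_, age_eq_prod hf, fun i => ⟨age_hereditaryCompositive _, ?_⟩⟩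
  obtain ⟨c, hc⟩ := hg i
  have : Nonempty (f ⁻¹' {i}) := by
    obtain ⟨v, rfl⟩ := c.exists_rep
    exact ⟨⟨v, hc⟩⟩
  exact age_hasNonnullMember _

end EdgeMaximal

/-! ### Additive properties -/

section Additive

variable {ι : Type} {H : SimpleGraph V} {Q : ι → GraphProperty}

theorem Hereditary.mem_of_mem_induce_fibre [Finite V] (hP : P.Hereditary) (hne : P.HasMember)
    (hadd : P.Additive) {f : V → ι} (hf : ∀ u v, G.Adj u v → f u = f v)
    (hG : ∀ i, P.Mem (G.induce (f ⁻¹' {i}))) : P.Mem G := by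
  classical
  have hfinset : ∀ s : Finset ι, P.Mem (G.induce (f ⁻¹' s)) := by
    intro s
    induction s using Finset.induction with
    | empty =>
      rw [Finset.coe_empty, Set.preimage_empty]
      exact hP.mem_of_isEmpty hne _
    | insert i s hi ih =>
      rw [Finset.coe_insert, Set.insert_eq, Set.preimage_union]
      refine hP _ _ (induce_union_isContained_sum ?_) (hadd _ _ (hG i) ih)
      rintro u rfl v hv huv
      exact hi (hf u v huv ▸ hv)
  have hrange : Set.range f ⊆ (Set.finite_range f).toFinset := by
    rw [Set.Finite.coe_toFinset]
  exact hP _ _ (isContained_induce_of_range_subset (Copy.id G) fun v _ => hrange ⟨v, rfl⟩)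
    (hfinset _)

/-- The disjoint union of countably many copies of `H`. -/
def copies (H : SimpleGraph V) : SimpleGraph (ℕ × V) where
  Adj x y := x.1 = y.1 ∧ H.Adj x.2 y.2
  symm := ⟨fun _ _ h => ⟨h.1.symm, h.2.symm⟩⟩
  loopless := ⟨fun _ h => h.2.ne rfl⟩

theorem isContained_copies (H : SimpleGraph V) : H ⊑ copies H :=
  ⟨⟨⟨fun v => (0, v), fun h => ⟨rfl, h⟩⟩, fun _ _ h => congrArg Prod.snd h⟩⟩

theorem age_copies_additive (H : SimpleGraph V) : (age (copies H)).Additive := by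
  rintro A B _ _ G K ⟨φ⟩ ⟨ψ⟩
  refine ⟨⟨⟨Sum.elim (fun a => (2 * (φ a).1, (φ a).2)) (fun b => (2 * (ψ b).1 + 1, (ψ b).2)),
    fun {x y} hxy => ?_⟩, fun x y hxy => ?_⟩⟩
  · rcases x with x | x <;> rcases y with y | y
    · have h : (copies H).Adj (φ x) (φ y) := φ.toHom.map_adj hxy
      exact ⟨congrArg (2 * ·) h.1, h.2⟩
    · exact (Bool.false_ne_true hxy).elim
    · exact (Bool.false_ne_true hxy).elim
    · have h : (copies H).Adj (ψ x) (ψ y) := ψ.toHom.map_adj hxy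
      exact ⟨congrArg (2 * · + 1) h.1, h.2⟩
  · rcases x with x | x <;> rcases y with y | y <;>
      obtain ⟨hcopy, hvertex⟩ := Prod.mk.inj hxy
    · exact congrArg _ (φ.injective (Prod.ext (show (φ x).1 = (φ y).1 by omega) hvertex))
    · omega
    · omega
    · exact congrArg _ (ψ.injective (Prod.ext (show (ψ x).1 = (ψ y).1 by omega) hvertex))

theorem age_copies_le (hP : P.Hereditary) (hadd : P.Additive) (h : age H ≤ P) :
    age (copies H) ≤ P := by
  rintro W _ G ⟨φ⟩
  have hφ : ∀ {u v}, G.Adj u v → (copies H).Adj (φ u) (φ v) := φ.toHom.map_adj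
  obtain ⟨U, _, K, hK⟩ := age_hasMember H
  refine hP.mem_of_mem_induce_fibre ⟨U, _, K, h K hK⟩ hadd (f := fun w => (φ w).1)
    (fun u v huv => (hφ huv).1) fun n => h _ ?_
  refine ⟨⟨⟨fun w => (φ w).2, fun huv => (hφ huv).2⟩, fun u v huv => Subtype.ext ?_⟩⟩
  exact φ.injective (Prod.ext (u.2.trans v.2.symm) huv)

theorem exists_forall_age_induce_le [Finite ι] (hQ : ∀ i, (Q i).Hereditary)
    (hne : ∀ i, (Q i).HasMember) (h : age H ≤ prod Q) :
    ∃ f : V → ι, ∀ i, age (H.induce (f ⁻¹' {i})) ≤ Q i := by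
  classical
  choose g hg using fun T => (mem_prod_iff hQ hne).1 ((age_le_iff (prod_hereditary hQ)).1 h T)
  obtain ⟨f, hf⟩ := Finset.rado_selection_subtype (β := fun _ : V => ι) g
  refine ⟨f, fun i W _ G ⟨φ⟩ => ?_⟩
  have hfin : (Set.range fun w => (φ w).1).Finite := Set.finite_range _
  obtain ⟨T, hsub, hfT⟩ := hf hfin.toFinset
  have hmem : ∀ w, (φ w).1 ∈ hfin.toFinset := fun w => hfin.mem_toFinset.2 ⟨w, rfl⟩
  have hgi : ∀ w, g T ⟨φ w, hsub (hmem w)⟩ = i := fun w => (hfT ⟨_, hmem w⟩).symm.trans (φ w).2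
  refine hQ i _ _ ⟨⟨⟨fun w => ⟨⟨φ w, hsub (hmem w)⟩, hgi w⟩, fun hab => φ.toHom.map_adj hab⟩,
    fun a b hab => φ.injective (Subtype.ext ?_)⟩⟩ (hg T i)
  exact congrArg (fun z => z.1.1) hab

-- A vertex goes to the part containing ultrafilter-almost all of its copies, so that any finitely
-- many vertices of a part agree with it on infinitely many copies of `H`.
theorem exists_forall_age_copies_induce_le [Finite ι] (hQ : ∀ i, (Q i).Hereditary)
    (hne : ∀ i, (Q i).HasMember) (h : age (copies H) ≤ prod Q) :
    ∃ f : V → ι, ∀ i, age (copies (H.induce (f ⁻¹' {i}))) ≤ Q i := by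
  obtain ⟨ψ, hψ⟩ := exists_forall_age_induce_le hQ hne h
  have hlim : ∀ v, ∃ i, ∀ᶠ n in (Filter.hyperfilter ℕ : Filter ℕ), ψ (n, v) = i := fun v =>
    Ultrafilter.eventually_exists_iff.1 (.of_forall fun n => ⟨ψ (n, v), rfl⟩)
  choose f hf using hlim
  refine ⟨f, fun i W _ G ⟨φ⟩ => hψ i G ?_⟩
  have hev : ∀ᶠ n in (Filter.hyperfilter ℕ : Filter ℕ), ∀ w, ψ (n, (φ w).2) = i :=
    Filter.eventually_all.2 fun w => (hf (φ w).2).mono fun n hn => hn.trans (φ w).2.2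
  have hinf : {n | ∀ w, ψ (n, (φ w).2) = i}.Infinite :=
    fun hfin => Filter.notMem_hyperfilter_of_finite hfin hev
  let e := hinf.natEmbedding
  refine ⟨⟨⟨fun w => ⟨(e (φ w).1, (φ w).2), (e (φ w).1).2 w⟩, fun {a b} hab => ?_⟩,
    fun a b hab => ?_⟩⟩
  · have hadj : (copies (H.induce (f ⁻¹' {i}))).Adj (φ a) (φ b) := φ.toHom.map_adj hab
    exact ⟨congrArg (fun n => (e n).1) hadj.1, hadj.2⟩
  · obtain ⟨hcopy, hvertex⟩ := Prod.mk.inj (Subtype.mk.inj hab)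
    exact φ.injective (Prod.ext (e.injective (Subtype.ext hcopy)) (Subtype.ext hvertex))

theorem surjective_of_age_induce_le [Finite ι] (hQ : ∀ i, (Q i).Hereditary)
    (hne : ∀ i, (Q i).HasNonnullMember) (hproper : (prod Q).Proper) (hH : prod Q ≤ age H)
    {f : V → ι} (hf : ∀ i, age (H.induce (f ⁻¹' {i})) ≤ Q i) : Function.Surjective f := by
  intro i
  have hstar := Hereditary.isMaximalStar_top (prod_hereditary hQ) (prod_hasMember Q) hproper
  obtain ⟨χ⟩ := hH _ hstar.1.1
  have hpart : ∀ j, (Q j).Mem ((⊤ : SimpleGraph _).induce (f ∘ χ ⁻¹' {j})) := fun j =>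
    hf j _ (induce_preimage_isContained χ (f ⁻¹' {j}))
  have hcard := (Hereditary.one_le_cliqueNumber (hQ i) (hne i) (proper_of_prod hproper i)).trans
    (hstar.cliqueNumber_le_card_fibre hQ (fun j => (hne j).hasMember) hproper hpart i)
  obtain ⟨a, ha⟩ := (Nat.card_pos_iff.1 hcard).1
  exact ⟨χ a, ha⟩

theorem exists_prod_eq_of_additive [Finite ι] (hQ : ∀ i, (Q i).Hereditary)
    (hne : ∀ i, (Q i).HasNonnullMember) (hprod : (prod Q).HereditaryCompositive)
    (hproper : (prod Q).Proper) (hadd : (prod Q).Additive) :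
    ∃ R : ι → GraphProperty, prod Q = prod R ∧
      ∀ i, (R i).HereditaryCompositive ∧ (R i).HasNonnullMember ∧ (R i).Additive := by
  obtain ⟨V, H, hH⟩ := hprod.exists_eq_age (prod_hasMember Q)
  obtain ⟨f, hf⟩ := exists_forall_age_copies_induce_le hQ (fun i => (hne i).hasMember)
    (age_copies_le hprod.1 hadd hH.ge)
  have hle : ∀ i, age (H.induce (f ⁻¹' {i})) ≤ age (copies (H.induce (f ⁻¹' {i}))) :=
    fun i => age_mono (isContained_copies _)
  have hsurj : Function.Surjective f :=
    surjective_of_age_induce_le hQ hne hproper hH.le fun i => (hle i).trans (hf i)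
  refine ⟨fun i => age (copies (H.induce (f ⁻¹' {i}))),
    le_antisymm (hH.le.trans (age_le_prod f hle)) (prod_mono hf), fun i => ?_⟩
  obtain ⟨v, hv⟩ := hsurj i
  have : Nonempty (f ⁻¹' {i}) := ⟨⟨v, hv⟩⟩
  exact ⟨age_hereditaryCompositive _, age_hasNonnullMember _, age_copies_additive _⟩

end Additive

end GraphProperty

theorem mainTheorem3 (P : GraphProperty) (hP : P.HereditaryCompositive)
    (hne : P.HasMember) (hproper : P.Proper) :
    (∃ Q : Fin P.dc → GraphProperty,
      P = GraphProperty.prod Q ∧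
        ∀ i, (Q i).HereditaryCompositive ∧ (Q i).HasNonnullMember ∧ (Q i).Indecomposable) ∧
    (∀ Q : Fin P.dc → GraphProperty,
      P = GraphProperty.prod Q →
        (∀ i, (Q i).HereditaryCompositive ∧ (Q i).HasNonnullMember) →
          ∀ i, (Q i).Indecomposable) ∧
    (P.Additive →
      ∃ Q : Fin P.dc → GraphProperty,
        P = GraphProperty.prod Q ∧
          ∀ i, (Q i).HereditaryCompositive ∧ (Q i).HasNonnullMember ∧ (Q i).Indecomposable ∧
            (Q i).Additive) := by
  have hind : ∀ Q : Fin P.dc → GraphProperty, P = GraphProperty.prod Q →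
      (∀ i, (Q i).HereditaryCompositive ∧ (Q i).HasNonnullMember) →
        ∀ i, (Q i).Indecomposable := fun Q hPQ hQ =>
    GraphProperty.indecomposable_of_dc_prod_le_card (fun i => (hQ i).1.1) (fun i => (hQ i).2)
      (hPQ ▸ hproper) (by rw [← hPQ, Nat.card_fin])
  obtain ⟨Q, hPQ, hQ⟩ := hP.exists_eq_prod hne hproper
  refine ⟨⟨Q, hPQ, fun i => ⟨(hQ i).1, (hQ i).2, hind Q hPQ hQ i⟩⟩, hind, fun hadd => ?_⟩
  obtain ⟨R, hQR, hR⟩ := GraphProperty.exists_prod_eq_of_additive (fun i => (hQ i).1.1)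
    (fun i => (hQ i).2) (hPQ ▸ hP) (hPQ ▸ hproper) (hPQ ▸ hadd)
  have hPR : P = GraphProperty.prod R := hPQ.trans hQR
  exact ⟨R, hPR, fun i => ⟨(hR i).1, (hR i).2.1,
    hind R hPR (fun i => ⟨(hR i).1, (hR i).2.1⟩) i, (hR i).2.2⟩⟩
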